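/- Throughout, graphs are finite and undirected, may have multiple edges, and have no loops. A proper $t$-edge coloring of a graph $G$ is a map $c : E(G) \to \{1,\dots,t\}$ giving distinct colors to any two distinct edges that share an end; the chromatic index $\chi'(G)$ is the least integer $t \ge 0$ for which such a coloring exists. An interval $t$-coloring is a proper $t$-edge coloring such that, at every vertex $v$, the set of colors of the edges incident to $v$ is an interval of integers (possibly empty); $G$ is interval colorable if it has an interval $t$-coloring for some $t$. The interval coloring thickness $\theta_{\mathrm{int}}(G)$ is the least integer $k \ge 0$ for which there are $k$ interval colorable subgraphs of $G$ such that every edge of $G$ belongs to exactly one of them (so $\theta_{\mathrm{int}}(G) = 0$ when $G$ has no edges). Theorem. For every graph $G$, $$\theta_{\mathrm{int}}(G) \le 2\left\lceil \frac{\chi'(G)}{5} \right\rceil .$$ -/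

import Mathlib

namespace Graph

/-- `c` is a proper `t`-edge coloring of the multigraph `G`: it maps the edges of `G` to
`{1, …, t}`, and distinct edges with a common end get distinct colors.
(The values of `c` outside the edge set of `G` are irrelevant.) -/
def IsProperEdgeColoring {α β : Type*} (G : Graph α β) (t : ℕ) (c : β → ℕ) : Prop :=
  (∀ e ∈ G.edgeSet, c e ∈ Set.Icc 1 t) ∧
    ∀ e f : β, ∀ v : α, G.Inc e v → G.Inc f v → e ≠ f → c e ≠ c f

/-- The chromatic index of `G`: the least `t` such that `G` has a proper `t`-edge coloring. -/
noncomputable def chromaticIndex {α β : Type*} (G : Graph α β) : ℕ :=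
  sInf {t : ℕ | ∃ c : β → ℕ, G.IsProperEdgeColoring t c}

/-- `c` is an interval `t`-coloring of `G`: a proper `t`-edge coloring such that, at every vertex
`v`, the set of colors of the edges incident to `v` is an interval of integers.
(At an isolated vertex that set is empty, which is `Set.Icc 1 0`.) -/
def IsIntervalColoring {α β : Type*} (G : Graph α β) (t : ℕ) (c : β → ℕ) : Prop :=
  G.IsProperEdgeColoring t c ∧
    ∀ v ∈ G.vertexSet, ∃ a b : ℕ, c '' G.incidenceSet v = Set.Icc a b

/-- `G` is interval colorable if it has an interval `t`-coloring for some `t`. -/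
def IsIntervalColorable {α β : Type*} (G : Graph α β) : Prop :=
  ∃ (t : ℕ) (c : β → ℕ), G.IsIntervalColoring t c

/-- `G` has a decomposition into `k` interval colorable subgraphs: there is a list of `k` interval
colorable subgraphs of `G` such that every edge of `G` is in exactly one subgraph of the list. -/
def HasIntervalDecomposition {α β : Type*} (G : Graph α β) (k : ℕ) : Prop :=
  ∃ H : Fin k → Graph α β,
    (∀ i, H i ≤ G ∧ (H i).IsIntervalColorable) ∧
      ∀ e ∈ G.edgeSet, ∃! i, e ∈ (H i).edgeSet

/-- The interval coloring thickness of `G`: the least `k` such that `G` has a decomposition into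
`k` interval colorable subgraphs. -/
noncomputable def intervalThickness {α β : Type*} (G : Graph α β) : ℕ :=
  sInf {k : ℕ | G.HasIntervalDecomposition k}

/-- For a graph with finitely many edges, the minimum in `chromaticIndex` is attained. -/
theorem exists_isProperEdgeColoring_chromaticIndex {α β : Type*} (G : Graph α β)
    (hE : G.edgeSet.Finite) : ∃ c : β → ℕ, G.IsProperEdgeColoring G.chromaticIndex c := by
  classical
  have hne : {t : ℕ | ∃ c : β → ℕ, G.IsProperEdgeColoring t c}.Nonempty := by
    have := hE.to_subtype
    obtain ⟨n, ⟨φ⟩⟩ := Finite.exists_equiv_fin G.edgeSet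
    refine ⟨n, fun e => if h : e ∈ G.edgeSet then (φ ⟨e, h⟩ : ℕ) + 1 else 0, ?_, ?_⟩
    · intro e he
      have := (φ ⟨e, he⟩).isLt
      simp only [he, dite_true, Set.mem_Icc]
      omega
    · intro e f v he hf hef h
      simp only [he.edge_mem, hf.edge_mem, dite_true, add_left_inj] at h
      exact hef (by simpa using φ.injective (Fin.ext h))
  exact Nat.sInf_mem hne

/-- For a graph with finitely many edges, the minimum in `intervalThickness` is attained. -/
theorem hasIntervalDecomposition_intervalThickness {α β : Type*} (G : Graph α β)
    (hE : G.edgeSet.Finite) : G.HasIntervalDecomposition G.intervalThickness := by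
  classical
  have hne : {k : ℕ | G.HasIntervalDecomposition k}.Nonempty := by
    have := hE.to_subtype
    obtain ⟨n, ⟨φ⟩⟩ := Finite.exists_equiv_fin G.edgeSet
    have hmem : ∀ (e f : β), f ∈ (G.restrict {e}).edgeSet ↔ f ∈ G.edgeSet ∧ f = e := by
      intro e f
      simp
    refine ⟨n, fun i => G.restrict {(φ.symm i : β)}, fun i => ⟨G.restrict_le, 1, fun _ => 1,
      ⟨fun _ _ => by simp, ?_⟩, ?_⟩, ?_⟩
    · intro e f v he hf hef
      exact absurd (((hmem _ _).1 he.edge_mem).2.trans ((hmem _ _).1 hf.edge_mem).2.symm) hef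
    · intro v _
      by_cases h : ((G.restrict {(φ.symm i : β)}).incidenceSet v).Nonempty
      · exact ⟨1, 1, by rw [h.image_const]; simp⟩
      · refine ⟨1, 0, ?_⟩
        rw [Set.not_nonempty_iff_eq_empty.1 h]
        simp
    · intro e he
      refine ⟨φ ⟨e, he⟩, (hmem _ _).2 ⟨he, by simp⟩, fun i hi => ?_⟩
      have h2 := ((hmem _ _).1 hi).2
      rw [← φ.apply_symm_apply i]
      congr 1
      exact Subtype.ext h2.symm
  exact Nat.sInf_mem hne

end Graph

/-! Cut an optimal coloring into blocks of five colors; each block must split into two interval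
colorable graphs. Recolor a block properly with 0, …, 4 so that color 4 is as rare as possible
(`IsFrugal`). Three colors give an interval coloring by placing the first two at 2, 3 and each edge
of the third at 1 or 4. Such an edge is blocked only if one of its ends sees just the first of the
two middle colors and the other end just the second. Start from the parts {0, 1, 4} and {2, 3}. A
4-edge blocked by 0, 1 but not by 2, 3 moves to the second part. If both pairs block it, it stays,
and the 1-edge at one of its ends moves instead, as a third color. Minimality makes this consistent.
The ends of a 4-edge cannot be separated by a Kempe change, so colors can be swapped at any third
chain end without disturbing them. Hence `IsFrugal.not_misses_of_path` (moved 1-edges do not meet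
moved 4-edges and block nothing new) and `IsFrugal.not_misses_opposite` (moved 1-edges are not
blocked). -/

namespace Graph

variable {α β : Type*} {G : Graph α β} {c : β → ℕ} {e f g h : β} {u v w x z : α} {i j k : ℕ}
  {K : Set α}

/-! ### Proper colorings and Kempe changes -/

/-- Distinct edges with a common end have distinct colors. -/
def Separates (G : Graph α β) (c : β → ℕ) : Prop :=
  ∀ ⦃e f : β⦄ ⦃v : α⦄, G.Inc e v → G.Inc f v → e ≠ f → c e ≠ c f

/-- No edge at `v` has color `k`. -/
def Misses (G : Graph α β) (c : β → ℕ) (v : α) (k : ℕ) : Prop :=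
  ∀ ⦃e : β⦄, G.Inc e v → c e ≠ k

/-- `K` is a union of components of the subgraph formed by the edges of colors `i` and `j`. -/
def SwapClosed (G : Graph α β) (c : β → ℕ) (i j : ℕ) (K : Set α) : Prop :=
  ∀ ⦃e : β⦄ ⦃u w : α⦄, G.IsLink e u w → c e = i ∨ c e = j → u ∈ K → w ∈ K

theorem SwapClosed.compl (hK : G.SwapClosed c i j K) : G.SwapClosed c i j Kᶜ :=
  fun _ _ _ h hc hu hw => hu (hK h.symm hc hw)

theorem Separates.eq_of_color (hc : G.Separates c) (he : G.Inc e v) (hf : G.Inc f v)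
    (h : c e = c f) : e = f :=
  by_contra fun hne => hc he hf hne h

open Classical in
/-- The other end of the edge of color `k` at `u`; it is `u` if there is no such edge. -/
noncomputable def mate (G : Graph α β) (c : β → ℕ) (k : ℕ) (u : α) : α :=
  if h : ∃ w e, G.IsLink e u w ∧ c e = k then h.choose else u

theorem Misses.mate_eq (h : G.Misses c u k) : G.mate c k u = u :=
  dif_neg fun ⟨_, _, hl, hc⟩ => h hl.inc_left hc

theorem Separates.mate_eq (hc : G.Separates c) (h : G.IsLink e u w) (hk : c e = k) :
    G.mate c k u = w := by
  have hex : ∃ w e, G.IsLink e u w ∧ c e = k := ⟨w, e, h, hk⟩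
  rw [mate, dif_pos hex]
  obtain ⟨e', hl, hk'⟩ := hex.choose_spec
  obtain rfl := hc.eq_of_color hl.inc_left h.inc_left (hk'.trans hk.symm)
  exact hl.right_unique h

theorem Separates.mate_mate (hc : G.Separates c) (k : ℕ) (u : α) :
    G.mate c k (G.mate c k u) = u := by
  by_cases h : ∃ w e, G.IsLink e u w ∧ c e = k
  · obtain ⟨w, e, hl, hk⟩ := h
    rw [hc.mate_eq hl hk, hc.mate_eq hl.symm hk]
  · have : G.mate c k u = u := dif_neg h
    rw [this, this]

/-- The walk from `u` that applies `a` and `b` alternately. -/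
def alternatingWalk (a b : α → α) (u : α) : ℕ → α
  | 0 => u
  | n + 1 => if Even n then a (alternatingWalk a b u n) else b (alternatingWalk a b u n)

/-- Starting from a fixed point `u` of `b`, the alternating walk of two involutions meets at most
one further point fixed by one of them before it stops. -/
theorem exists_closed_of_involutive {a b : α → α} (ha : a.Involutive) (hb : b.Involutive)
    (hu : b u = u) :
    ∃ K : Set α, u ∈ K ∧ (∀ p ∈ K, a p ∈ K ∧ b p ∈ K) ∧
      ∀ p ∈ K, ∀ q ∈ K, p ≠ u → q ≠ u → a p = p ∨ b p = p → a q = q ∨ b q = q → p = q := by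
  set y := alternatingWalk a b u with hy
  have y0 : y 0 = u := rfl
  have hs : ∀ n, y (n + 1) = if Even n then a (y n) else b (y n) := fun n => rfl
  have hback : ∀ n, y n = if Even n then a (y (n + 1)) else b (y (n + 1)) := by
    intro n
    rw [hs]
    split_ifs
    · exact (ha _).symm
    · exact (hb _).symm
  refine ⟨{p | ∃ n, p = y n ∧ ∀ m < n, y (m + 1) ≠ y m}, ⟨0, y0.symm, by simp⟩, ?_, ?_⟩
  · rintro _ ⟨n, rfl, hn⟩
    have hfwd : ∃ m, y (n + 1) = y m ∧ ∀ l < m, y (l + 1) ≠ y l := by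
      by_cases h : y (n + 1) = y n
      · exact ⟨n, h, hn⟩
      · refine ⟨n + 1, rfl, fun l hl => ?_⟩
        rcases Nat.lt_succ_iff_lt_or_eq.1 hl with h' | rfl
        · exact hn l h'
        · exact h
    have hbwd : ∃ m, (if Even n then b (y n) else a (y n)) = y m ∧ ∀ l < m, y (l + 1) ≠ y l := by
      cases n with
      | zero => exact ⟨0, by simp [y0, hu], by simp⟩
      | succ n =>
        refine ⟨n, ?_, fun l hl => hn l (by omega)⟩
        rw [hback n]
        by_cases h : Even n <;> simp [h, Nat.even_add_one]
    rw [hs] at hfwd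
    by_cases h : Even n
    · rw [if_pos h] at hfwd hbwd
      exact ⟨hfwd, hbwd⟩
    · rw [if_neg h] at hfwd hbwd
      exact ⟨hbwd, hfwd⟩
  -- A point other than `u` is entered by an involution that moves it; if it is fixed at all, the
  -- other involution fixes it, and that one comes next, so the walk stops there.
  · have key : ∀ n, (∀ m < n, y (m + 1) ≠ y m) → y n ≠ u → a (y n) = y n ∨ b (y n) = y n →
        y (n + 1) = y n := by
      intro n hn hnu hfix
      cases n with
      | zero => exact absurd y0 hnu
      | succ n =>
        have h1 := hn n (by omega)
        have h2 := hback n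
        rw [hs (n + 1)]
        by_cases h : Even n
        · rw [if_pos h] at h2
          rw [if_neg (by simpa [Nat.even_add_one] using h)]
          exact hfix.resolve_left fun h3 => h1 (h2.trans h3).symm
        · rw [if_neg h] at h2
          rw [if_pos (by simpa [Nat.even_add_one] using h)]
          exact hfix.resolve_right fun h3 => h1 (h2.trans h3).symm
    rintro _ ⟨n, rfl, hn⟩ _ ⟨m, rfl, hm⟩ hnu hmu hfn hfm
    rcases lt_trichotomy n m with h | rfl | h
    · exact absurd (key n hn hnu hfn) (hm n h)
    · rfl
    · exact absurd (key m hm hmu hfm) (hn m h)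

/-- The mates in colors `i` and `j` are involutions, and missing a color makes a vertex a fixed
point. -/
theorem Separates.exists_swapClosed (hc : G.Separates c)
    (hu : G.Misses c u i ∨ G.Misses c u j) :
    ∃ K : Set α, u ∈ K ∧ G.SwapClosed c i j K ∧
      ∀ p ∈ K, ∀ q ∈ K, p ≠ u → q ≠ u → G.Misses c p i ∨ G.Misses c p j →
        G.Misses c q i ∨ G.Misses c q j → p = q := by
  wlog hj : G.Misses c u j generalizing i j
  · obtain ⟨K, h1, h2, h3⟩ := this hu.symm (hu.resolve_right hj)
    exact ⟨K, h1, fun e u w hl hc => h2 hl hc.symm, fun p hp q hq hpu hqu h h' =>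
      h3 p hp q hq hpu hqu h.symm h'.symm⟩
  obtain ⟨K, h1, h2, h3⟩ := exists_closed_of_involutive (a := G.mate c i) (b := G.mate c j)
    (hc.mate_mate i) (hc.mate_mate j) hj.mate_eq
  refine ⟨K, h1, ?_, fun p hp q hq hpu hqu h h' => h3 p hp q hq hpu hqu
    (h.imp Misses.mate_eq Misses.mate_eq) (h'.imp Misses.mate_eq Misses.mate_eq)⟩
  rintro e p q hl (hk | hk) hp
  · exact hc.mate_eq hl hk ▸ (h2 p hp).1
  · exact hc.mate_eq hl hk ▸ (h2 p hp).2

/-- A component of the edges of two colors has at most two ends: a third one is separated from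
two ends that cannot be separated from one another. -/
theorem Separates.exists_swapClosed_of_three (hc : G.Separates c)
    (hv : G.Misses c v i ∨ G.Misses c v j) (hw : G.Misses c w i ∨ G.Misses c w j)
    (hx : G.Misses c x i ∨ G.Misses c x j) (hvw : v ≠ w) (hvx : v ≠ x) (hwx : w ≠ x)
    (h : ∀ K, G.SwapClosed c i j K → v ∈ K → w ∈ K) :
    ∃ K, G.SwapClosed c i j K ∧ x ∈ K ∧ v ∉ K ∧ w ∉ K := by
  obtain ⟨K, h1, h2, h3⟩ := hc.exists_swapClosed hv
  have hwK := h K h2 h1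
  -- The complement of the chain through `v` and `w` serves; it need not be a single chain.
  refine ⟨Kᶜ, h2.compl, fun hxK => hwx ?_, fun h => h h1, fun h => h hwK⟩
  exact h3 w hwK x hxK hvw.symm hvx.symm hw hx

open Classical in
/-- Interchange the colors `i` and `j` at the vertices of `K`. -/
noncomputable def kempeSwap (G : Graph α β) (c : β → ℕ) (i j : ℕ) (K : Set α) (e : β) : ℕ :=
  if ∃ u ∈ K, G.Inc e u then Equiv.swap i j (c e) else c e

theorem kempeSwap_of_mem (he : G.Inc e v) (hv : v ∈ K) :
    G.kempeSwap c i j K e = Equiv.swap i j (c e) :=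
  if_pos ⟨v, hv, he⟩

theorem SwapClosed.kempeSwap_of_notMem (hK : G.SwapClosed c i j K) (he : G.Inc e v)
    (hv : v ∉ K) : G.kempeSwap c i j K e = c e := by
  rw [kempeSwap]
  split_ifs with h
  · obtain ⟨u, hu, heu⟩ := h
    refine Equiv.swap_apply_of_ne_of_ne (fun hi => ?_) (fun hj => ?_)
    all_goals
      obtain ⟨w, hl⟩ := heu
      rcases he.eq_or_eq_of_isLink hl with rfl | rfl
      · exact hv hu
      · exact hv (hK hl (by tauto) hu)
  · rfl

theorem SwapClosed.separates (hK : G.SwapClosed c i j K) (hc : G.Separates c) :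
    G.Separates (G.kempeSwap c i j K) := by
  intro e f v he hf hne
  by_cases hv : v ∈ K
  · rw [kempeSwap_of_mem he hv, kempeSwap_of_mem hf hv]
    exact fun h => hc he hf hne ((Equiv.swap i j).injective h)
  · rw [hK.kempeSwap_of_notMem he hv, hK.kempeSwap_of_notMem hf hv]
    exact hc he hf hne

theorem kempeSwap_eq_iff (hi : i ≠ k) (hj : j ≠ k) :
    G.kempeSwap c i j K e = k ↔ c e = k := by
  rw [kempeSwap]
  split_ifs
  · rw [Equiv.swap_apply_eq_iff, Equiv.swap_apply_of_ne_of_ne hi.symm hj.symm]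
  · rfl

theorem kempeSwap_lt (hi : i < k) (hj : j < k) (he : c e < k) :
    G.kempeSwap c i j K e < k := by
  rw [kempeSwap]
  split_ifs
  · rw [Equiv.swap_apply_def]
    split_ifs <;> assumption
  · exact he

theorem Misses.kempeSwap_of_mem (h : G.Misses c v i) (hv : v ∈ K) :
    G.Misses (G.kempeSwap c i j K) v j := by
  intro e he
  rw [Graph.kempeSwap_of_mem he hv, Ne, Equiv.swap_apply_eq_iff, Equiv.swap_apply_right]
  exact h he

theorem SwapClosed.misses_iff (hK : G.SwapClosed c i j K) (hv : v ∉ K) :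
    G.Misses (G.kempeSwap c i j K) v k ↔ G.Misses c v k := by
  refine forall₂_congr fun e he => ?_
  rw [hK.kempeSwap_of_notMem he hv]

open Classical in
theorem Separates.update (hc : G.Separates c)
    (h : ∀ ⦃v⦄, G.Inc f v → ∀ ⦃e⦄, G.Inc e v → e ≠ f → c e ≠ k) :
    G.Separates (Function.update c f k) := by
  intro e g v he hg hne
  by_cases hef : e = f
  · subst hef
    rw [Function.update_self, Function.update_of_ne hne.symm]
    exact (h he hg hne.symm).symm
  · rw [Function.update_of_ne hef]
    by_cases hgf : g = f
    · subst hgf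
      rw [Function.update_self]
      exact h hg he hne
    · rw [Function.update_of_ne hgf]
      exact hc he hg hne

/-! ### Colorings with fewest edges of color 4 -/

/-- A coloring with the colors `0, …, 4` in which color `4` is used as rarely as possible. -/
structure IsFrugal (G : Graph α β) (c : β → ℕ) : Prop where
  separates : G.Separates c
  lt_five : ∀ e ∈ G.edgeSet, c e < 5
  ncard_le : ∀ d : β → ℕ, G.Separates d → (∀ e ∈ G.edgeSet, d e < 5) →
    {e ∈ G.edgeSet | c e = 4}.ncard ≤ {e ∈ G.edgeSet | d e = 4}.ncard

theorem IsFrugal.kempeSwap (hc : G.IsFrugal c) (hi : i < 4) (hj : j < 4)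
    (hK : G.SwapClosed c i j K) : G.IsFrugal (G.kempeSwap c i j K) where
  separates := hK.separates hc.separates
  lt_five e he := kempeSwap_lt (by omega) (by omega) (hc.lt_five e he)
  ncard_le d hd hd5 := by
    have := hc.ncard_le d hd hd5
    simpa only [kempeSwap_eq_iff (hi.ne) (hj.ne)] using this

/-- Otherwise `f` could take color `i`, leaving fewer edges of color 4. -/
theorem IsFrugal.not_misses (hc : G.IsFrugal c) (hE : G.edgeSet.Finite) (hf : G.IsLink f v w)
    (hf4 : c f = 4) (hi : i < 4) (hv : G.Misses c v i) (hw : G.Misses c w i) : False := by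
  classical
  have h := hc.ncard_le (Function.update c f i) (hc.separates.update ?_) ?_
  · refine h.not_gt (Set.ncard_lt_ncard ?_ (hE.subset fun e he => he.1))
    refine ⟨?_, fun hss => ?_⟩
    · rintro e ⟨he, he4⟩
      by_cases hef : e = f
      · subst hef
        simp at he4
        omega
      · exact ⟨he, by simpa [hef] using he4⟩
    · have := (hss ⟨hf.edge_mem, hf4⟩).2
      simp at this
      omega
  · intro u hu e he _
    rcases hu.eq_or_eq_of_isLink hf with rfl | rfl
    exacts [hv he, hw he]
  · intro e he
    by_cases hef : e = f
    · subst hef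
      simp; omega
    · simpa [hef] using hc.lt_five e he

/-- The ends of an edge of color `4` cannot be separated by a Kempe change. -/
theorem IsFrugal.mem_of_mem (hc : G.IsFrugal c) (hE : G.edgeSet.Finite) (hf : G.IsLink f v w)
    (hf4 : c f = 4) (hi : i < 4) (hj : j < 4) (hv : G.Misses c v i) (hw : G.Misses c w j)
    (hK : G.SwapClosed c i j K) (hvK : v ∈ K) : w ∈ K := by
  by_contra hwK
  exact (hc.kempeSwap hi hj hK).not_misses hE hf
    ((kempeSwap_eq_iff hi.ne hj.ne).2 hf4) hj
    (hv.kempeSwap_of_mem hvK) ((hK.misses_iff hwK).2 hw)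

open Classical in
theorem IsFrugal.update (hc : G.IsFrugal c) (he : G.IsLink e w x) (he4 : c e ≠ 4) (hi : i < 4)
    (hw : G.Misses c w i) (hx : G.Misses c x i) : G.IsFrugal (Function.update c e i) where
  separates := hc.separates.update fun u hu g hg _ => by
    rcases hu.eq_or_eq_of_isLink he with rfl | rfl
    exacts [hw hg, hx hg]
  lt_five g hg := by
    by_cases hge : g = e
    · subst hge
      simp; omega
    · simpa [hge] using hc.lt_five g hg
  ncard_le d hd hd5 := by
    refine le_of_eq_of_le (congrArg _ ?_) (hc.ncard_le d hd hd5)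
    ext g
    by_cases hge : g = e
    · subst hge
      simp [he4, hi.ne]
    · simp [hge]

/-- Recoloring `e` with `i` frees color 1 at `w`, so `f` could then take color 1. -/
theorem IsFrugal.not_misses_of_adj (hc : G.IsFrugal c) (hE : G.edgeSet.Finite)
    (hf : G.IsLink f v w) (hf4 : c f = 4) (hv : G.Misses c v 1) (he : G.IsLink e w x)
    (he1 : c e = 1) (hi : i < 4) (hi1 : i ≠ 1) (hw : G.Misses c w i) (hx : G.Misses c x i) :
    False := by
  classical
  have hfe : f ≠ e := by rintro rfl; omega
  refine (hc.update he (by omega) hi hw hx).not_misses hE hf (by simpa [hfe] using hf4)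
    (i := 1) (by norm_num) ?_ ?_
  · intro g hg
    have := hv hg
    by_cases hge : g = e
    · subst hge; exact absurd he1 this
    · simpa [hge] using this
  · intro g hg
    by_cases hge : g = e
    · subst hge; simpa using hi1
    · simpa [hge] using fun h => hge (hc.separates.eq_of_color hg he.inc_left (h.trans he1.symm))

/-- Exchanging colors 1 and 4 along the path `f`, `e`, `h` stays proper and trades two edges of
color 4 for one. -/
theorem IsFrugal.not_misses_of_path_aux (hc : G.IsFrugal c) (hE : G.edgeSet.Finite)
    (hf : G.IsLink f v w) (hf4 : c f = 4) (hv : G.Misses c v 1) (he : G.IsLink e w x)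
    (he1 : c e = 1) (hh : G.IsLink h x z) (hh4 : c h = 4) (hfh : f ≠ h) (hz : G.Misses c z 1) :
    False := by
  classical
  have hfe : f ≠ e := by rintro rfl; omega
  have hhe : h ≠ e := by rintro rfl; omega
  -- The inner value 5 is overwritten by the outermost update.
  have hsep : G.Separates (Function.update (Function.update (Function.update
      (Function.update c e 5) f 1) h 1) e 4) := by
    have hat : ∀ ⦃g u⦄, G.Inc g u → g ≠ e → g ≠ f → g ≠ h → (G.Inc e u ∨ G.Inc f u ∨ G.Inc h u) →
        c g ≠ 1 := by
      intro g u hg hge _ _ hu hg1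
      have hex : ∀ y, G.Inc e y → g ≠ e → G.Inc g y → False := fun y hy hne hgy =>
        hne (hc.separates.eq_of_color hgy hy (hg1.trans he1.symm))
      rcases hu with hu | hu | hu
      · exact hex u hu hge hg
      · rcases hu.eq_or_eq_of_isLink hf with rfl | rfl
        · exact hv hg hg1
        · exact hex _ he.inc_left hge hg
      · rcases hu.eq_or_eq_of_isLink hh with rfl | rfl
        · exact hex _ he.inc_right hge hg
        · exact hz hg hg1
    have h4 : ∀ ⦃g u⦄, G.Inc g u → g ≠ f → g ≠ h → G.Inc e u → c g ≠ 4 := by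
      intro g u hg hgf hgh hu hg4
      rcases hu.eq_or_eq_of_isLink he with rfl | rfl
      · exact hgf (hc.separates.eq_of_color hg hf.inc_right (hg4.trans hf4.symm))
      · exact hgh (hc.separates.eq_of_color hg hh.inc_left (hg4.trans hh4.symm))
    intro g g' u hg hg' hne
    have hfh' : ¬ (G.Inc f u ∧ G.Inc h u) := fun h =>
      hfh (hc.separates.eq_of_color h.1 h.2 (hf4.trans hh4.symm))
    have h0 := hc.separates hg hg' hne
    simp only [Function.update_apply]
    grind
  refine (hc.ncard_le _ hsep ?_).not_gt ?_
  · intro g hg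
    have := hc.lt_five g hg
    simp only [Function.update_apply]
    grind
  · have hfin : {g ∈ G.edgeSet | c g = 4}.Finite := hE.subset fun g hg => hg.1
    have hsub : {g ∈ G.edgeSet | Function.update (Function.update (Function.update
      (Function.update c e 5) f 1) h 1) e 4 g = 4} ⊆
        insert e (({g ∈ G.edgeSet | c g = 4} \ {f}) \ {h}) := by
      rintro g ⟨hg, hg4⟩
      simp only [Function.update_apply] at hg4
      simp only [Set.mem_insert_iff, Set.mem_sdiff, Set.mem_ofPred_eq, Set.mem_singleton_iff]
      grind
    have h1 := Set.ncard_le_ncard hsub ((hfin.sdiff.sdiff).insert e)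
    have h2 := Set.ncard_insert_le e (({g ∈ G.edgeSet | c g = 4} \ {f}) \ {h})
    have h3 := Set.ncard_sdiff_singleton_lt_of_mem
      (show f ∈ {g ∈ G.edgeSet | c g = 4} from ⟨hf.edge_mem, hf4⟩) hfin
    have h4 := Set.ncard_sdiff_singleton_lt_of_mem
      (show h ∈ {g ∈ G.edgeSet | c g = 4} \ {f} from ⟨⟨hh.edge_mem, hh4⟩, hfh.symm⟩) hfin.sdiff
    omega

theorem IsLink.ne_of_misses (hf : G.IsLink f v w)
    (hv : G.Misses c v 1) (he : G.IsLink e w x) (hwx : w ≠ x) (he1 : c e = 1)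
    (hh : G.Inc h x) : f ≠ h := by
  rintro rfl
  rcases hh.eq_or_eq_of_isLink hf with rfl | rfl
  · exact hv he.inc_right he1
  · exact hwx rfl

/-- If `f = vw` and `h = xz` have color `4`, the edge `wx` has color `1`, and `v`, `w` miss the
colors `1`, `0`, then `z` misses neither of these two colors. -/
theorem IsFrugal.not_misses_of_path [G.Loopless] (hc : G.IsFrugal c) (hE : G.edgeSet.Finite)
    (hf : G.IsLink f v w) (hf4 : c f = 4) (hv : G.Misses c v 1) (hw : G.Misses c w 0)
    (he : G.IsLink e w x) (he1 : c e = 1) (hh : G.IsLink h x z) (hh4 : c h = 4) :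
    ¬ G.Misses c z 0 ∧ ¬ G.Misses c z 1 := by
  have hfh := hf.ne_of_misses hv he he.ne he1 hh.inc_left
  refine ⟨fun hz => ?_, hc.not_misses_of_path_aux hE hf hf4 hv he he1 hh hh4 hfh⟩
  have hne : ∀ y, G.Inc f y → y ≠ z := by
    rintro y hy rfl
    exact hfh (hc.separates.eq_of_color hy hh.inc_right (hf4.trans hh4.symm))
  -- A swap of 0 and 1 at `z`, away from `v` and `w`, turns the missing color 0 into 1 and keeps the
  -- color of `e`.
  obtain ⟨K, hK, hzK, hvK, hwK⟩ := hc.separates.exists_swapClosed_of_three (i := 0) (j := 1)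
    (.inr hv) (.inl hw) (.inl hz) hf.ne (hne v hf.inc_left) (hne w hf.inc_right)
    fun K hK => hc.mem_of_mem hE hf hf4 (i := 1) (j := 0) (by norm_num) (by norm_num) hv hw
      (fun _ _ _ hl hk => hK hl hk.symm)
  exact (hc.kempeSwap (by norm_num) (by norm_num) hK).not_misses_of_path_aux hE hf
    ((kempeSwap_eq_iff (by norm_num) (by norm_num)).2 hf4) ((hK.misses_iff hvK).2 hv) he
    ((hK.kempeSwap_of_notMem he.inc_left hwK).trans he1) hh
    ((kempeSwap_eq_iff (by norm_num) (by norm_num)).2 hh4) hfh (hz.kempeSwap_of_mem hzK)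

/-- If `x` also missed `j`, a swap of `i` and `j` away from `v` and `w` would make `x` miss `i`, as
`w` does, against `IsFrugal.not_misses_of_adj`. -/
theorem IsFrugal.not_misses_opposite [G.Loopless] (hc : G.IsFrugal c) (hE : G.edgeSet.Finite)
    (hf : G.IsLink f v w) (hf4 : c f = 4) (hv : G.Misses c v 1) (he : G.IsLink e w x)
    (he1 : c e = 1) (hi : i < 4) (hj : j < 4) (hi1 : i ≠ 1) (hj1 : j ≠ 1)
    (hvj : G.Misses c v j) (hwi : G.Misses c w i) : ¬ G.Misses c x j := by
  intro hxj
  have hvx : v ≠ x := by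
    rintro rfl
    exact hv he.inc_right he1
  obtain ⟨K, hK, hxK, hvK, hwK⟩ := hc.separates.exists_swapClosed_of_three
    (.inl hvj) (.inr hwi) (.inl hxj) hf.ne hvx he.ne
    fun K hK => hc.mem_of_mem hE hf hf4 hj hi hvj hwi hK
  exact (hc.kempeSwap hj hi hK).not_misses_of_adj hE hf
    ((kempeSwap_eq_iff hj.ne hi.ne).2 hf4) ((hK.misses_iff hvK).2 hv) he
    ((kempeSwap_eq_iff hj1 hi1).2 he1) hi hi1 ((hK.misses_iff hwK).2 hwi)
    (hxj.kempeSwap_of_mem hxK)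

/-! ### Interval colorings from three colors -/

/-- A coloring with the colors `0`, `1`, `2` gives an interval coloring if each edge of color `2`
can be placed either below or above the other two colors. -/
theorem Separates.isIntervalColorable (hc : G.Separates c) (h3 : ∀ e ∈ G.edgeSet, c e < 3)
    (h : ∀ f u w, G.IsLink f u w → c f = 2 → ¬ G.Misses c u 0 → G.Misses c u 1 →
      G.Misses c w 0 → ¬ G.Misses c w 1 → False) : G.IsIntervalColorable := by
  classical
  -- An edge of color 2 goes on top exactly when one of its ends demands it by seeing color 1 but
  -- not color 0.
  set P : β → Prop := fun e => ∃ u, G.Inc e u ∧ G.Misses c u 0 ∧ ¬ G.Misses c u 1 with hP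
  set d : β → ℕ := fun e => if c e = 0 then 2 else if c e = 1 then 3 else if P e then 4 else 1
    with hd
  refine ⟨4, d, ⟨fun e _ => ?_, fun e f v he hf hne => ?_⟩, fun v hv => ?_⟩
  · simp only [hd, Set.mem_Icc]
    split_ifs <;> omega
  · have h1 := hc he hf hne
    have h2 := h3 e he.edge_mem
    have h3 := h3 f hf.edge_mem
    simp only [hd]
    split_ifs <;> omega
  · have hmem : ∀ n, n ∈ d '' G.incidenceSet v ↔ (n = 2 ∧ ¬ G.Misses c v 0) ∨
        (n = 3 ∧ ¬ G.Misses c v 1) ∨ (n = 1 ∧ ∃ e, G.Inc e v ∧ c e = 2 ∧ ¬ P e) ∨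
        (n = 4 ∧ ∃ e, G.Inc e v ∧ c e = 2 ∧ P e) := by
      intro n
      simp only [Misses, Set.mem_image, mem_incidenceSet]
      constructor
      · rintro ⟨e, he, rfl⟩
        have := h3 e he.edge_mem
        by_cases h0 : c e = 0
        · exact .inl ⟨by simp [hd, h0], fun hm => hm he h0⟩
        by_cases h1 : c e = 1
        · exact .inr (.inl ⟨by simp [hd, h1], fun hm => hm he h1⟩)
        by_cases hp : P e
        · exact .inr (.inr (.inr ⟨by simp [hd, h0, h1, hp], e, he, by omega, hp⟩))
        · exact .inr (.inr (.inl ⟨by simp [hd, h0, h1, hp], e, he, by omega, hp⟩))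
      · push Not
        rintro (⟨rfl, e, he, h⟩ | ⟨rfl, e, he, h⟩ | ⟨rfl, e, he, h, hp⟩ | ⟨rfl, e, he, h, hp⟩)
        · exact ⟨e, he, by simp [hd, h]⟩
        · exact ⟨e, he, by simp [hd, h]⟩
        · exact ⟨e, he, by simp [hd, h, hp]⟩
        · exact ⟨e, he, by simp [hd, h, hp]⟩
    have h14 : (∃ e, G.Inc e v ∧ c e = 2 ∧ ¬ P e) → ¬ ∃ e, G.Inc e v ∧ c e = 2 ∧ P e := by
      rintro ⟨e, he, he2, hp⟩ ⟨f, hf, hf2, hp'⟩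
      exact hp (hc.eq_of_color he hf (he2.trans hf2.symm) ▸ hp')
    have h1 : (∃ e, G.Inc e v ∧ c e = 2 ∧ ¬ P e) → ¬ G.Misses c v 1 → ¬ G.Misses c v 0 :=
      fun ⟨e, he, _, hp⟩ hm hm0 => hp ⟨v, he, hm0, hm⟩
    have h4 : (∃ e, G.Inc e v ∧ c e = 2 ∧ P e) → ¬ G.Misses c v 0 → ¬ G.Misses c v 1 := by
      rintro ⟨e, he, he2, u, hu, hu0, hu1⟩ hm hm1
      have huv : v ≠ u := by
        rintro rfl
        exact hm hu0
      exact h e v u (isLink_iff_inc.2 ⟨he, hu, fun y hy => (he.eq_or_eq_or_eq hu hy).elim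
        (fun h => absurd h huv) (fun h => h.imp Eq.symm Eq.symm)⟩) he2 hm hm1 hu0 hu1
    have hIcc : ∃ a b : ℕ, ∀ n, n ∈ d '' G.incidenceSet v ↔ a ≤ n ∧ n ≤ b := by
      simp only [hmem]
      generalize (∃ e, G.Inc e v ∧ c e = 2 ∧ ¬ P e) = Q1 at *
      generalize (∃ e, G.Inc e v ∧ c e = 2 ∧ P e) = Q4 at *
      generalize G.Misses c v 0 = Q2 at *
      generalize G.Misses c v 1 = Q3 at *
      refine ⟨if Q1 then 1 else if ¬ Q2 then 2 else if ¬ Q3 then 3 else if Q4 then 4 else 1,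
        if Q4 then 4 else if ¬ Q3 then 3 else if ¬ Q2 then 2 else if Q1 then 1 else 0, fun n => ?_⟩
      by_cases q1 : Q1 <;> by_cases q2 : Q2 <;> by_cases q3 : Q3 <;> by_cases q4 : Q4 <;>
        simp_all <;> omega
    obtain ⟨a, b, hab⟩ := hIcc
    exact ⟨a, b, Set.ext hab⟩

/-! ### The two parts of a frugal coloring -/

/-- `f = vw` has color `4`; of the colors `i`, `j`, only `i` occurs at `v` and only `j` at `w`. -/
structure IsOpposed (G : Graph α β) (c : β → ℕ) (i j : ℕ) (f : β) (v w : α) : Prop where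
  isLink : G.IsLink f v w
  color : c f = 4
  left_misses : G.Misses c v j
  left_not_misses : ¬ G.Misses c v i
  right_misses : G.Misses c w i
  right_not_misses : ¬ G.Misses c w j

/-- The edges of color `4` that block an interval coloring of the colors `0`, `1`, `4` but not of
the colors `2`, `3`, `4`. -/
def transferEdges (G : Graph α β) (c : β → ℕ) : Set β :=
  {f | (∃ v w, G.IsOpposed c 0 1 f v w) ∧ ¬ ∃ v w, G.IsOpposed c 2 3 f v w}

/-- The edges of color `1` next to an edge of color `4` that blocks both interval colorings. -/
def detachedEdges (G : Graph α β) (c : β → ℕ) : Set β :=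
  {e | c e = 1 ∧ ∃ f v w, G.IsOpposed c 0 1 f v w ∧ (∃ v' w', G.IsOpposed c 2 3 f v' w') ∧
    G.Inc e w}

/-- The second part of the decomposition given by a frugal coloring. -/
def secondPart (G : Graph α β) (c : β → ℕ) : Set β :=
  {e | c e = 2 ∨ c e = 3 ∨ e ∈ G.transferEdges c ∨ e ∈ G.detachedEdges c}

theorem color_of_mem_transferEdges (h : e ∈ G.transferEdges c) : c e = 4 := by
  obtain ⟨⟨_, _, h⟩, _⟩ := h
  exact h.color

theorem IsFrugal.isIntervalColorable_first [G.Loopless] (hc : G.IsFrugal c)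
    (hE : G.edgeSet.Finite) : (G.restrict (G.secondPart c)ᶜ).IsIntervalColorable := by
  have hcol : ∀ e ∈ G.edgeSet, e ∉ G.secondPart c → c e = 0 ∨ c e = 1 ∨ c e = 4 := by
    intro e he hn
    have := hc.lt_five e he
    simp only [secondPart, Set.mem_ofPred_eq, not_or] at hn
    omega
  refine Separates.isIntervalColorable (c := fun e => min (c e) 2) ?_
    (fun e _ => by omega) ?_
  · intro e f v he hf hne
    beta_reduce
    rw [restrict_inc] at he hf
    have h1 := hcol e he.1.edge_mem he.2
    have h2 := hcol f hf.1.edge_mem hf.2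
    have h3 := hc.separates he.1 hf.1 hne
    omega
  · intro f u w hf hf2 hu0 hu1 hw0 hw1
    simp only [Misses, restrict_inc, not_forall, not_not] at hu0 hu1 hw0 hw1
    rw [restrict_isLink, and_comm] at hf
    obtain ⟨a, ⟨hau, haA⟩, ha⟩ := hu0
    obtain ⟨b, ⟨hbw, hbA⟩, hb⟩ := hw1
    have ha0 : c a = 0 := by omega
    have hb1 : c b = 1 := by omega
    have hf4 : c f = 4 := by
      have := hcol f hf.1.edge_mem hf.2
      omega
    -- Edges of color 0 never leave the first part.
    have hw0' : G.Misses c w 0 := by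
      intro g hg hg0
      refine hw0 ⟨hg, ?_⟩ (by omega)
      rintro (h | h | h | h)
      · omega
      · omega
      · have := color_of_mem_transferEdges h
        omega
      · have := h.1
        omega
    by_cases hu : G.Misses c u 1
    · have hop : G.IsOpposed c 0 1 f u w :=
        ⟨hf.1, hf4, hu, fun h => h hau ha0, hw0', fun h => h hbw hb1⟩
      by_cases hB : ∃ v w, G.IsOpposed c 2 3 f v w
      · exact hbA (.inr (.inr (.inr ⟨hb1, f, u, w, hop, hB, hbw⟩)))
      · exact hf.2 (.inr (.inr (.inl ⟨⟨u, w, hop⟩, hB⟩)))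
    -- Here the 1-edge `g` at `u` was detached, so `f` could be newly blocked; the path lemma
    -- excludes this when `u` is the far end of `g`.
    · simp only [Misses, not_forall, not_not] at hu
      obtain ⟨g, hgu, hg1⟩ := hu
      have hgB : g ∈ G.secondPart c := by
        by_contra hgA
        exact hu1 ⟨hgu, hgA⟩ (by omega)
      rcases hgB with h | h | h | ⟨_, f', v', w', hop, -, hgw⟩
      · omega
      · omega
      · have := color_of_mem_transferEdges h
        omega
      · obtain ⟨x', hl⟩ := hgw
        rcases hgu.eq_or_eq_of_isLink hl with rfl | rfl
        · exact hop.right_misses hau ha0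
        · exact (hc.not_misses_of_path hE hop.isLink hop.color hop.left_misses hop.right_misses
            hl hg1 hf.1 hf4).1 hw0'

/-- At its near end a detached edge meets only the doubly blocked 4-edge, which is not transferred.
At its far end the path lemma applies, since both ends of a transferred edge miss 0 or 1. -/
theorem IsFrugal.not_inc_of_mem_transferEdges [G.Loopless] (hc : G.IsFrugal c)
    (hE : G.edgeSet.Finite) (he : e ∈ G.detachedEdges c) (hf : f ∈ G.transferEdges c)
    (hev : G.Inc e v) : ¬ G.Inc f v := by
  intro hfv
  have hf4 := color_of_mem_transferEdges hf
  obtain ⟨he1, f', v', w', hop, hB, x', hl⟩ := he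
  rcases hev.eq_or_eq_of_isLink hl with rfl | rfl
  · obtain rfl := hc.separates.eq_of_color hfv hop.isLink.inc_right (hf4.trans hop.color.symm)
    exact hf.2 hB
  · obtain ⟨z, hz⟩ := hfv
    have := hc.not_misses_of_path hE hop.isLink hop.color hop.left_misses hop.right_misses
      hl he1 hz hf4
    obtain ⟨⟨p, q, hpq⟩, -⟩ := hf
    rcases hz.right_eq_or_eq hpq.isLink with rfl | rfl
    · exact this.2 hpq.left_misses
    · exact this.1 hpq.right_misses

theorem IsFrugal.isIntervalColorable_second [G.Loopless] (hc : G.IsFrugal c)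
    (hE : G.edgeSet.Finite) : (G.restrict (G.secondPart c)).IsIntervalColorable := by
  classical
  set d : β → ℕ := fun e => if c e = 2 then 0 else if c e = 3 then 1 else 2 with hd
  have hd0 : ∀ e, d e = 0 ↔ c e = 2 := fun e => by grind
  have hd1 : ∀ e, d e = 1 ↔ c e = 3 := fun e => by grind
  have hd2 : ∀ e, d e = 2 ↔ c e ≠ 2 ∧ c e ≠ 3 := fun e => by grind
  have hd3 : ∀ e, d e < 3 := fun e => by grind
  have hm0 : ∀ v, (G.restrict (G.secondPart c)).Misses d v 0 ↔ G.Misses c v 2 := by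
    intro v
    simp only [Misses, restrict_inc, Ne, hd0]
    exact ⟨fun h e he h2 => h ⟨he, .inl h2⟩ h2, fun h e he => h he.1⟩
  have hm1 : ∀ v, (G.restrict (G.secondPart c)).Misses d v 1 ↔ G.Misses c v 3 := by
    intro v
    simp only [Misses, restrict_inc, Ne, hd1]
    exact ⟨fun h e he h2 => h ⟨he, .inr (.inl h2)⟩ h2, fun h e he => h he.1⟩
  refine Separates.isIntervalColorable (c := d) ?_ (fun e _ => hd3 e) ?_
  · intro e f v he hf hne hef
    rw [restrict_inc] at he hf
    have hcef := hc.separates he.1 hf.1 hne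
    by_cases h2 : d e = 2
    · have h2' := hef ▸ h2
      rw [hd2] at h2 h2'
      rcases he.2 with h | h | h | h
      · omega
      · omega
      · rcases hf.2 with h' | h' | h' | h'
        · omega
        · omega
        · exact hcef ((color_of_mem_transferEdges h).trans (color_of_mem_transferEdges h').symm)
        · exact hc.not_inc_of_mem_transferEdges hE h' h hf.1 he.1
      · rcases hf.2 with h' | h' | h' | h'
        · omega
        · omega
        · exact hc.not_inc_of_mem_transferEdges hE h h' he.1 hf.1
        · exact hcef (h.1.trans h'.1.symm)
    · have h0 := hd0 e
      have h1 := hd1 e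
      have h0' := hd0 f
      have h1' := hd1 f
      have := hd3 e
      omega
  · intro t u w ht ht2 hu0 hu1 hw0 hw1
    rw [restrict_isLink, and_comm] at ht
    rw [hm0] at hu0 hw0
    rw [hm1] at hu1 hw1
    rw [hd2] at ht2
    rcases ht.2 with h | h | h | ⟨h1, f, v', w', hop, ⟨p, q, hB⟩, x', hl⟩
    · omega
    · omega
    · exact h.2 ⟨u, w, ht.1, color_of_mem_transferEdges h, hu1, hu0, hw0, hw1⟩
    -- If the detached edge were blocked, its far end would miss the same one of the colors 2, 3 as
    -- `v'`. The cases are the orientations of both edges.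
    · rcases ht.1.eq_and_eq_or_eq_and_eq hl with ⟨rfl, rfl⟩ | ⟨rfl, rfl⟩
      · rcases hop.isLink.eq_and_eq_or_eq_and_eq hB.isLink with ⟨rfl, rfl⟩ | ⟨rfl, rfl⟩
        · exact hu0 hB.right_misses
        · exact hc.not_misses_opposite hE hop.isLink hop.color hop.left_misses hl h1
            (i := 3) (j := 2) (by norm_num) (by norm_num) (by norm_num) (by norm_num)
            hB.right_misses hu1 hw0
      · rcases hop.isLink.eq_and_eq_or_eq_and_eq hB.isLink with ⟨rfl, rfl⟩ | ⟨rfl, rfl⟩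
        · exact hc.not_misses_opposite hE hop.isLink hop.color hop.left_misses hl h1
            (i := 2) (j := 3) (by norm_num) (by norm_num) (by norm_num) (by norm_num)
            hB.left_misses hw0 hu1
        · exact hw1 hB.left_misses

/-! ### From five colors to any number -/

theorem Separates.exists_isFrugal (hc : G.Separates c) (h5 : ∀ e ∈ G.edgeSet, c e < 5) :
    ∃ d, G.IsFrugal d := by
  have hne : {n | ∃ d : β → ℕ, G.Separates d ∧ (∀ e ∈ G.edgeSet, d e < 5) ∧
      {e ∈ G.edgeSet | d e = 4}.ncard = n}.Nonempty := ⟨_, c, hc, h5, rfl⟩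
  obtain ⟨d, hd, hd5, hn⟩ := Nat.sInf_mem hne
  exact ⟨d, hd, hd5, fun d' h h' => hn ▸ Nat.sInf_le ⟨d', h, h', rfl⟩⟩

/-- A loopless graph with a proper coloring of its edges by five colors has a decomposition into
two interval colorable subgraphs. -/
theorem Separates.exists_isIntervalColorable [G.Loopless] (hE : G.edgeSet.Finite)
    (hc : G.Separates c) (h5 : ∀ e ∈ G.edgeSet, c e < 5) :
    ∃ B : Set β, (G.restrict B).IsIntervalColorable ∧ (G.restrict Bᶜ).IsIntervalColorable := by
  obtain ⟨d, hd⟩ := hc.exists_isFrugal h5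
  exact ⟨G.secondPart d, hd.isIntervalColorable_second hE, hd.isIntervalColorable_first hE⟩

theorem IsProperEdgeColoring.hasIntervalDecomposition [G.Loopless] (hE : G.edgeSet.Finite)
    {t q : ℕ} (hc : G.IsProperEdgeColoring t c) (hq : t ≤ 5 * q) :
    G.HasIntervalDecomposition (2 * q) := by
  classical
  have hB : ∀ i : ℕ, ∃ B : Set β,
      ((G.restrict {e | (c e - 1) / 5 = i}).restrict B).IsIntervalColorable ∧
      ((G.restrict {e | (c e - 1) / 5 = i}).restrict Bᶜ).IsIntervalColorable := by
    intro i
    have : (G.restrict {e | (c e - 1) / 5 = i}).Loopless := Loopless.anti restrict_le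
    refine Separates.exists_isIntervalColorable (c := fun e => (c e - 1) % 5)
      (hE.subset restrict_le.edgeSet_mono) ?_ fun e _ => Nat.mod_lt _ (by norm_num)
    intro e f v he hf hne hef
    rw [restrict_inc] at he hf
    have h1 := (hc.1 e he.1.edge_mem).1
    have h2 := (hc.1 f hf.1.edge_mem).1
    have h3 := hc.2 e f v he.1 hf.1 hne
    have h4 := he.2
    have h5 := hf.2
    simp only [Set.mem_ofPred_eq] at h4 h5
    beta_reduce at hef
    omega
  choose B hB1 hB2 using hB
  -- The index `k` encodes the block `k / 2` and, by its parity, one of the two parts of that block.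
  refine ⟨fun k => (G.restrict {e | (c e - 1) / 5 = (k : ℕ) / 2}).restrict
    {e | e ∈ B ((k : ℕ) / 2) ↔ (k : ℕ) % 2 = 0}, fun k => ⟨restrict_le.trans restrict_le, ?_⟩, ?_⟩
  · rcases Nat.mod_two_eq_zero_or_one k with h | h
    · simpa [h] using hB1 (k / 2)
    · have := hB2 (k / 2)
      simpa [h, Set.compl_def] using this
  · intro e he
    have hce := hc.1 e he
    rw [Set.mem_Icc] at hce
    have hlt : (c e - 1) / 5 < q := by omega
    refine ⟨⟨2 * ((c e - 1) / 5) + if e ∈ B ((c e - 1) / 5) then 0 else 1, ?_⟩, ?_, ?_⟩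
    · split_ifs <;> omega
    · have h2 : (2 * ((c e - 1) / 5) + if e ∈ B ((c e - 1) / 5) then 0 else 1) / 2
          = (c e - 1) / 5 := by split_ifs <;> omega
      simp only [edgeSet_restrict, Set.mem_inter_iff, Set.mem_ofPred_eq, h2]
      refine ⟨⟨he, trivial⟩, ?_⟩
      split_ifs with h <;> simp [h]
    · rintro ⟨k, hk⟩ hek
      simp only [edgeSet_restrict, Set.mem_inter_iff, Set.mem_ofPred_eq] at hek
      obtain ⟨⟨-, h1⟩, h2⟩ := hek
      rw [Fin.mk.injEq]
      rw [← h1] at h2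
      split_ifs with h
      · have := h2.1 h
        omega
      · have : k % 2 ≠ 0 := fun h' => h (h2.2 h')
        omega

end Graph

theorem mainTheorem2 {α β : Type*} (G : Graph α β) (hV : G.vertexSet.Finite)
    (hE : G.edgeSet.Finite) (hG : G.Loopless) :
    G.intervalThickness ≤ 2 * ⌈(G.chromaticIndex : ℚ) / 5⌉₊ := by
  obtain ⟨c, hc⟩ := G.exists_isProperEdgeColoring_chromaticIndex hE
  refine Nat.sInf_le (hc.hasIntervalDecomposition hE ?_)
  have h := Nat.le_ceil ((G.chromaticIndex : ℚ) / 5)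
  rw [div_le_iff₀ (by norm_num)] at h
  have h' : G.chromaticIndex ≤ ⌈(G.chromaticIndex : ℚ) / 5⌉₊ * 5 := by exact_mod_cast h
  omega
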